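/- Let $0<p<1$, $q=1-p$, and let $\xi_1,\xi_2,\ldots$ be independent coin tosses with $\mathbb P(\xi_i=1)=p$ (heads) and $\mathbb P(\xi_i=0)=q$ (tails). For integers $\ell\ge 1$ and $n\ge 0$ let $R_\ell(n)$ be the number of runs of length exactly $\ell$ in the first $n$ tosses, where a run is a nonempty interval $I\subset\{1,\ldots,n\}$ with $\xi_i=1$ for all $i\in I$ that is not properly contained in another interval of $\{1,\ldots,n\}$ with this property. Let $\nu\ge 1$ and let $\theta_1,\ldots,\theta_\nu$ be positive real numbers. Let $(n_k)_{k\ge 0}$ be a sequence of nonnegative integers with $n_k\to\infty$, and for $j=1,\ldots,\nu$ let $(\ell_j(k))_{k\ge 0}$ be a sequence of positive integers such that, for every $k$, the numbers $\ell_1(k),\ldots,\ell_\nu(k)$ are pairwise distinct, and such that $$\lim_{k\to\infty} n_k\, p^{\ell_j(k)}\, q=\theta_j,\qquad j=1,\ldots,\nu.$$ Then, as $k\to\infty$, the random vector $\bigl(R_{\ell_1(k)}(n_k),\ldots,R_{\ell_\nu(k)}(n_k)\bigr)$ converges in distribution to $\operatorname{Poisson}(\theta_1 q)\times\cdots\times\operatorname{Poisson}(\theta_\nu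 q)$, that is, to a vector of independent Poisson random variables with means $\theta_1q,\ldots,\theta_\nu q$. -/

import Mathlib

open MeasureTheory ProbabilityTheory Filter Topology

/-- `x` records the outcomes of coin tosses (`1` for heads, `0` for tails), `x i` being the outcome
of toss number `i + 1`. `IsHeadInterval x n I` says that `I` is a nonempty interval of indices
among those of the first `n` tosses, all of which show heads. -/
def IsHeadInterval (x : ℕ → ℕ) (n : ℕ) (I : Finset ℕ) : Prop :=
  ∃ a b : ℕ, a ≤ b ∧ b < n ∧ I = Finset.Icc a b ∧ ∀ i ∈ I, x i = 1

/-- A run in the first `n` tosses: an interval of heads that is contained in no larger one. -/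
def IsRun (x : ℕ → ℕ) (n : ℕ) (I : Finset ℕ) : Prop :=
  Maximal (IsHeadInterval x n) I

/-- `runCount x ℓ n` is the number `R_ℓ(n)` of runs of length (exactly) `ℓ` in the first `n`
tosses. -/
noncomputable def runCount (x : ℕ → ℕ) (ℓ n : ℕ) : ℕ :=
  Set.ncard {I : Finset ℕ | IsRun x n I ∧ I.card = ℓ}

/-! The proof is a Stein–Chen argument by planting runs. Write R for the vector of counts, e_j for
the unit vectors and L_j for the mean of R_{ℓ_j}. Summing over the start of a marked run gives
(r_j+1) P(R = r+e_j) = Σ_a P(run of length ℓ_j at a, R = r+e_j). The run at a is independent of the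
tosses outside its block and two neighbours, so each term is P(run at a) times the probability that
the sequence with a planted run has counts r+e_j (`measureReal_runAt_and_runCount`). Planting
changes R to R+e_j unless a long head block lies nearby (`runCount_plantRun`), which is unlikely.
Hence (r_j+1) P(R = r+e_j) ≈ L_j P(R = r) (`abs_stein_runCount_le`). Since L_j → θ_j q, this
recursion fixes the limiting point masses up to P(R = 0). Markov's inequality gives tightness, which
fixes that constant (`tendsto_measureReal_singleton_of_stein`). On a countable space, convergence of
point masses suffices. -/

/-! ### Combinatorics of runs and of planting a run. -/

/-- A run of length `ℓ` starts at index `a`, in the first `n` tosses. -/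
def RunAt (x : ℕ → ℕ) (ℓ n a : ℕ) : Prop :=
  a + ℓ ≤ n ∧ (∀ i, a ≤ i → i < a + ℓ → x i = 1) ∧ (∀ i, i + 1 = a → x i ≠ 1) ∧
    (a + ℓ < n → x (a + ℓ) ≠ 1)

/-- The outcomes `x`, overwritten so that a run of length `ℓ` starts at index `a`. -/
def plantRun (x : ℕ → ℕ) (ℓ a : ℕ) : ℕ → ℕ := fun i ↦
  if a ≤ i ∧ i < a + ℓ then 1 else if i + 1 = a ∨ i = a + ℓ then 0 else x i

/-- Some interval of heads of length `ℓ'` meets or touches the block that `plantRun x ℓ a`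
overwrites. -/
def HeadsNear (x : ℕ → ℕ) (ℓ ℓ' a : ℕ) : Prop :=
  ∃ b, b ≤ a + ℓ + 1 ∧ a ≤ b + ℓ' + 1 ∧ ∀ i, b ≤ i → i < b + ℓ' → x i = 1

lemma isRun_Icc_iff {x : ℕ → ℕ} {n a b : ℕ} (hab : a ≤ b) :
    IsRun x n (Finset.Icc a b) ↔ RunAt x (b + 1 - a) n a := by
  have hb : a + (b + 1 - a) = b + 1 := by omega
  constructor
  · rintro ⟨⟨c, d, hcd, hd, hI, hx⟩, hmax⟩
    have hc : a ∈ Finset.Icc c d := hI ▸ Finset.mem_Icc.2 ⟨le_rfl, hab⟩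
    have hc' : b ∈ Finset.Icc c d := hI ▸ Finset.mem_Icc.2 ⟨hab, le_rfl⟩
    have hbn : b < n := by simp only [Finset.mem_Icc] at hc'; omega
    simp only [Finset.mem_Icc] at hx
    refine ⟨by omega, fun i h1 h2 ↦ hx i ⟨h1, by omega⟩, ?_, ?_⟩
    · intro i hi h1
      have := hmax (y := Finset.Icc i b) ⟨i, b, by omega, hbn, rfl, fun j hj ↦ by
        rw [Finset.mem_Icc] at hj
        rcases eq_or_ne j i with rfl | h
        · exact h1
        · exact hx j (by omega)⟩ (Finset.Icc_subset_Icc (by omega) le_rfl)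
      have := this (Finset.mem_Icc.2 ⟨le_rfl, by omega⟩)
      simp only [Finset.mem_Icc] at this
      omega
    · rw [hb]
      intro hlt h1
      have := hmax (y := Finset.Icc a (b + 1)) ⟨a, b + 1, by omega, hlt, rfl, fun j hj ↦ by
        rw [Finset.mem_Icc] at hj
        rcases eq_or_ne j (b + 1) with rfl | h
        · exact h1
        · exact hx j (by omega)⟩ (Finset.Icc_subset_Icc le_rfl (by omega))
      have := this (Finset.mem_Icc.2 ⟨by omega, le_rfl⟩)
      simp only [Finset.mem_Icc] at this
      omega
  · rintro ⟨h1, h2, h3, h4⟩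
    rw [hb] at h1 h2 h4
    refine ⟨⟨a, b, hab, h1, rfl, fun i hi ↦ ?_⟩, ?_⟩
    · rw [Finset.mem_Icc] at hi
      exact h2 i hi.1 (by omega)
    · rintro J ⟨c, d, hcd, hd, rfl, hx⟩ hsub
      have ha := Finset.mem_Icc.1 (hsub (Finset.mem_Icc.2 ⟨le_rfl, hab⟩))
      have hb := Finset.mem_Icc.1 (hsub (Finset.mem_Icc.2 ⟨hab, le_rfl⟩))
      refine Finset.Icc_subset_Icc ?_ ?_
      · by_contra hlt
        exact h3 (a - 1) (by omega) (hx _ (Finset.mem_Icc.2 (by omega)))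
      · by_contra hlt
        exact h4 (by omega) (hx _ (Finset.mem_Icc.2 (by omega)))

open Classical in
lemma runCount_eq_card {x : ℕ → ℕ} {ℓ n : ℕ} (hℓ : 0 < ℓ) :
    runCount x ℓ n = ((Finset.range n).filter (RunAt x ℓ n)).card := by
  have hinj : Function.Injective fun a ↦ Finset.Icc a (a + ℓ - 1) := by
    intro a b hab
    dsimp only at hab
    have h1 : a ∈ Finset.Icc b (b + ℓ - 1) := hab ▸ Finset.mem_Icc.2 (by omega)
    have h2 : b ∈ Finset.Icc a (a + ℓ - 1) := hab ▸ Finset.mem_Icc.2 (by omega)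
    rw [Finset.mem_Icc] at h1 h2
    omega
  rw [runCount, ← Finset.card_image_of_injective _ hinj, ← Set.ncard_coe_finset]
  congr 1
  ext I
  simp only [Set.mem_ofPred_eq, Finset.coe_image, Set.mem_image, Finset.coe_filter, Finset.mem_range]
  constructor
  · rintro ⟨hI, hcard⟩
    obtain ⟨a, b, hab, hb, rfl, -⟩ := hI.1
    rw [isRun_Icc_iff hab] at hI
    rw [Nat.card_Icc] at hcard
    rw [hcard] at hI
    exact ⟨a, ⟨by omega, hI⟩, by congr 1; omega⟩
  · rintro ⟨a, ⟨ha, hR⟩, rfl⟩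
    rw [isRun_Icc_iff (by omega), Nat.card_Icc]
    have : a + ℓ - 1 + 1 - a = ℓ := by omega
    rw [this]
    exact ⟨hR, rfl⟩

lemma RunAt.congr {x y : ℕ → ℕ} {ℓ n a : ℕ} (hℓ : 0 < ℓ)
    (h : ∀ i, a ≤ i + 1 → i ≤ a + ℓ → i < n → (x i = 1 ↔ y i = 1)) (hx : RunAt x ℓ n a) :
    RunAt y ℓ n a := by
  obtain ⟨h1, h2, h3, h4⟩ := hx
  refine ⟨h1, fun i hi hi' ↦ (h i (by omega) (by omega) (by omega)).1 (h2 i hi hi'),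
    fun i hi ↦ ?_, fun hlt ↦ ?_⟩
  · rw [Ne, ← h i (by omega) (by omega) (by omega)]
    exact h3 i hi
  · rw [Ne, ← h _ (by omega) le_rfl hlt]
    exact h4 hlt

lemma runAt_congr {x y : ℕ → ℕ} {ℓ n a : ℕ} (hℓ : 0 < ℓ)
    (h : ∀ i, a ≤ i + 1 → i ≤ a + ℓ → i < n → (x i = 1 ↔ y i = 1)) :
    RunAt x ℓ n a ↔ RunAt y ℓ n a :=
  ⟨.congr hℓ h, .congr hℓ fun i h1 h2 h3 ↦ (h i h1 h2 h3).symm⟩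

lemma runCount_congr {x y : ℕ → ℕ} {ℓ n : ℕ} (hℓ : 0 < ℓ)
    (h : ∀ i, i < n → (x i = 1 ↔ y i = 1)) : runCount x ℓ n = runCount y ℓ n := by
  classical
  rw [runCount_eq_card hℓ, runCount_eq_card hℓ]
  congr 1
  exact Finset.filter_congr fun a _ ↦ runAt_congr hℓ fun i _ _ hi ↦ h i hi

lemma RunAt.plantRun_eq_one_iff {x : ℕ → ℕ} {ℓ n a : ℕ} (h : RunAt x ℓ n a) {i : ℕ}
    (hi : i < n) : x i = 1 ↔ plantRun x ℓ a i = 1 := by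
  obtain ⟨h1, h2, h3, h4⟩ := h
  unfold plantRun
  split_ifs with h5 h6
  · simp [h2 i h5.1 h5.2]
  · rcases h6 with h6 | rfl
    · simp [h3 i h6]
    · simp [h4 hi]
  · rfl

lemma RunAt.runCount_plantRun {x : ℕ → ℕ} {ℓ ℓ' n a : ℕ} (hℓ' : 0 < ℓ') (h : RunAt x ℓ n a) :
    runCount (plantRun x ℓ a) ℓ' n = runCount x ℓ' n :=
  (runCount_congr hℓ' fun _ hi ↦ h.plantRun_eq_one_iff hi).symm

lemma runAt_plantRun_self {x : ℕ → ℕ} {ℓ n a : ℕ} (ha : a + ℓ ≤ n) :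
    RunAt (plantRun x ℓ a) ℓ n a := by
  refine ⟨ha, fun i h1 h2 ↦ by simp [plantRun, h1, h2], fun i h ↦ ?_, fun _ ↦ by simp [plantRun]⟩
  have : ¬ (a ≤ i ∧ i < a + ℓ) := by omega
  simp [plantRun, this, h]

lemma plantRun_of_far {x : ℕ → ℕ} {ℓ a i : ℕ} (h : i + 1 < a ∨ a + ℓ < i) :
    plantRun x ℓ a i = x i := by
  unfold plantRun
  rw [if_neg (by omega), if_neg (by omega)]

lemma plantRun_pred {x : ℕ → ℕ} {ℓ a i : ℕ} (h : i + 1 = a) : plantRun x ℓ a i = 0 := by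
  unfold plantRun
  rw [if_neg (by omega), if_pos (by omega)]

lemma plantRun_end {x : ℕ → ℕ} {ℓ a : ℕ} : plantRun x ℓ a (a + ℓ) = 0 := by
  simp [plantRun]

lemma plantRun_of_mem {x : ℕ → ℕ} {ℓ a i : ℕ} (h : a ≤ i) (h' : i < a + ℓ) :
    plantRun x ℓ a i = 1 := by
  simp [plantRun, h, h']

lemma not_runAt_of_not_headsNear {x : ℕ → ℕ} {ℓ ℓ' n a : ℕ} (h : ¬ HeadsNear x ℓ ℓ' a) {b : ℕ}
    (h1 : b ≤ a + ℓ + 1) (h2 : a ≤ b + ℓ' + 1) : ¬ RunAt x ℓ' n b :=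
  fun hb ↦ h ⟨b, h1, h2, hb.2.1⟩

/-- The planted zeros at `a - 1` and `a + ℓ` confine a nearby run of the new sequence. Outside the
planted block it would be a head block of `x`, excluded by `h`; inside, maximality forces it to be
the whole block. -/
lemma runAt_plantRun_iff {x : ℕ → ℕ} {ℓ ℓ' n a b : ℕ} (hℓ : 0 < ℓ) (hℓ' : 0 < ℓ')
    (ha : a + ℓ ≤ n) (h : ¬ HeadsNear x ℓ ℓ' a) :
    RunAt (plantRun x ℓ a) ℓ' n b ↔ RunAt x ℓ' n b ∨ (b = a ∧ ℓ' = ℓ) := by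
  -- Outside this window the tosses `b - 1, …, b + ℓ'`, which decide a run at `b`, are not
  -- overwritten.
  by_cases hnear : b ≤ a + ℓ + 1 ∧ a ≤ b + ℓ' + 1
  · simp only [not_runAt_of_not_headsNear h hnear.1 hnear.2, false_or]
    constructor
    · rintro ⟨h1, h2, h3, h4⟩
      have hne : ∀ i, b ≤ i → i < b + ℓ' → i + 1 ≠ a ∧ i ≠ a + ℓ := by
        intro i hi hi'
        refine ⟨fun h ↦ ?_, ?_⟩
        · simpa [plantRun_pred h] using h2 i hi hi'
        · rintro rfl
          simpa [plantRun_end] using h2 _ hi hi'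
      by_cases hdisj : b + ℓ' < a ∨ a + ℓ < b
      · exact absurd ⟨b, hnear.1, hnear.2, fun i hi hi' ↦ by
          rw [← h2 i hi hi', plantRun_of_far (by omega)]⟩ h
      have e1 := hne (a - 1)
      have e2 := hne (a + ℓ)
      have e3 : b ≤ a + ℓ := by omega
      have hab : a ≤ b ∧ b + ℓ' ≤ a + ℓ := by
        by_cases h0 : a = 0
        · omega
        by_cases h5 : b + ℓ' = a
        · exact absurd ⟨b, hnear.1, hnear.2, fun i hi hi' ↦ by
            rw [← h2 i hi hi', plantRun_of_far (by have := hne i hi hi'; omega)]⟩ h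
        omega
      have hba : b = a := by
        by_contra hlt
        refine h3 (b - 1) ?_ (plantRun_of_mem ?_ ?_) <;> omega
      subst hba
      refine ⟨rfl, ?_⟩
      by_contra hlt
      exact h4 (by omega) (plantRun_of_mem (by omega) (by omega))
    · rintro ⟨rfl, rfl⟩
      exact runAt_plantRun_self ha
  · rw [runAt_congr hℓ' (y := x)]
    · constructor
      · exact Or.inl
      · rintro (h | ⟨rfl, rfl⟩)
        · exact h
        · omega
    · intro i h1 h2 _
      rw [plantRun_of_far (by omega)]

lemma runCount_plantRun {x : ℕ → ℕ} {ℓ ℓ' n a : ℕ} (hℓ : 0 < ℓ) (hℓ' : 0 < ℓ')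
    (ha : a + ℓ ≤ n) (h : ¬ HeadsNear x ℓ ℓ' a) :
    runCount (plantRun x ℓ a) ℓ' n = runCount x ℓ' n + if ℓ' = ℓ then 1 else 0 := by
  classical
  rw [runCount_eq_card hℓ', runCount_eq_card hℓ']
  simp only [runAt_plantRun_iff hℓ hℓ' ha h]
  split_ifs with hl
  · rw [← Finset.card_insert_of_notMem (a := a)]
    · congr 1
      ext b
      simp only [Finset.mem_filter, Finset.mem_range, Finset.mem_insert]
      constructor
      · tauto
      · rintro (rfl | h)
        · exact ⟨by omega, Or.inr ⟨rfl, hl⟩⟩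
        · tauto
    · simp [not_runAt_of_not_headsNear (n := n) h (b := a) (by omega) (by omega)]
  · simp [hl]

/-! ### Probability estimates for the tosses and the approximate Stein identity. -/

section CoinTosses

variable {Ω : Type*} [MeasurableSpace Ω] {P : Measure Ω} {ξ : ℕ → Ω → ℕ}

lemma DependsOn.measurableSet_setOf {φ : (ℕ → ℕ) → Prop} {S : Finset ℕ} (hφ : DependsOn φ S)
    (hξ : ∀ i, Measurable (ξ i)) : MeasurableSet {ω | φ fun i ↦ ξ i ω} := by
  obtain ⟨g, rfl⟩ := dependsOn_iff_exists_comp.1 hφ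
  have h : Measurable fun ω (i : S) ↦ ξ i ω := measurable_pi_lambda _ fun i ↦ hξ i
  exact h (Set.to_countable {z | g z}).measurableSet

lemma measureReal_and_of_dependsOn {φ ψ : (ℕ → ℕ) → Prop} {S T : Finset ℕ}
    (hφ : DependsOn φ S) (hψ : DependsOn ψ T) (hST : Disjoint S T)
    (hξ : ∀ i, Measurable (ξ i)) (hind : iIndepFun ξ P) :
    P.real {ω | φ (fun i ↦ ξ i ω) ∧ ψ (fun i ↦ ξ i ω)} =
      P.real {ω | φ fun i ↦ ξ i ω} * P.real {ω | ψ fun i ↦ ξ i ω} := by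
  obtain ⟨f, rfl⟩ := dependsOn_iff_exists_comp.1 hφ
  obtain ⟨g, rfl⟩ := dependsOn_iff_exists_comp.1 hψ
  have := (hind.indepFun_finset S T hST hξ).measure_inter_preimage_eq_mul {z | f z} {z | g z}
    (Set.to_countable _).measurableSet (Set.to_countable _).measurableSet
  simp only [Measure.real, ← ENNReal.toReal_mul]
  exact congrArg ENNReal.toReal this

variable {p : ℝ}

lemma measureReal_heads (hp : 0 ≤ p) (hind : iIndepFun ξ P)
    (hone : ∀ i, P {ω | ξ i ω = 1} = ENNReal.ofReal p) (b m : ℕ) :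
    P.real {ω | ∀ i, b ≤ i → i < b + m → ξ i ω = 1} = p ^ m := by
  have := hind.measure_inter_preimage_eq_mul (Finset.Ico b (b + m)) (sets := fun _ ↦ {1})
    fun _ _ ↦ MeasurableSet.singleton _
  have h2 : ∀ i, P (ξ i ⁻¹' {1}) = ENNReal.ofReal p := hone
  simp only [h2, Finset.prod_const, Nat.card_Ico, add_tsub_cancel_left] at this
  rw [Measure.real, ← ENNReal.toReal_ofReal (pow_nonneg hp m), ENNReal.ofReal_pow hp, ← this]
  congr 2
  ext ω
  simp

lemma measureReal_ne_one [IsProbabilityMeasure P]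
    (hp : 0 ≤ p) (hξ : ∀ i, Measurable (ξ i))
    (hone : ∀ i, P {ω | ξ i ω = 1} = ENNReal.ofReal p) (i : ℕ) :
    P.real {ω | ξ i ω ≠ 1} = 1 - p := by
  have h : {ω | ξ i ω ≠ 1} = {ω | ξ i ω = 1}ᶜ := rfl
  have hm : MeasurableSet {ω | ξ i ω = 1} := hξ i (MeasurableSet.singleton 1)
  rw [h, probReal_compl_eq_one_sub hm, Measure.real, hone,
    ENNReal.toReal_ofReal hp]

lemma dependsOn_heads (b m : ℕ) :
    DependsOn (fun x : ℕ → ℕ ↦ ∀ i, b ≤ i → i < b + m → x i = 1) (Finset.Ico b (b + m)) := by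
  intro x y h
  simp only [eq_iff_iff]
  refine forall_congr' fun i ↦ forall_congr' fun h1 ↦ forall_congr' fun h2 ↦ ?_
  rw [h i (by simp [h1, h2])]

lemma dependsOn_runAt {ℓ : ℕ} (hℓ : 0 < ℓ) (n a : ℕ) :
    DependsOn (fun x ↦ RunAt x ℓ n a) (Finset.Icc (a - 1) (a + ℓ)) := fun x y h ↦
  eq_iff_iff.2 <| runAt_congr hℓ fun i h1 h2 _ ↦ by
    rw [h i (by simp only [Finset.coe_Icc, Set.mem_Icc]; omega)]

lemma measureReal_runAt_le [IsProbabilityMeasure P] (hp : 0 ≤ p) (hind : iIndepFun ξ P)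
    (hone : ∀ i, P {ω | ξ i ω = 1} = ENNReal.ofReal p) (ℓ n a : ℕ) :
    P.real {ω | RunAt (fun i ↦ ξ i ω) ℓ n a} ≤ p ^ ℓ := by
  rw [← measureReal_heads hp hind hone a ℓ]
  exact measureReal_mono fun ω h ↦ h.2.1

/-- The probability that a run occurs at a place away from the two ends. -/
lemma measureReal_runAt [IsProbabilityMeasure P]
    (hp : 0 ≤ p) (hξ : ∀ i, Measurable (ξ i)) (hind : iIndepFun ξ P)
    (hone : ∀ i, P {ω | ξ i ω = 1} = ENNReal.ofReal p) {ℓ n a : ℕ} (ha : a + 1 + ℓ < n) :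
    P.real {ω | RunAt (fun i ↦ ξ i ω) ℓ n (a + 1)} = p ^ ℓ * (1 - p) ^ 2 := by
  have hne : ∀ j, DependsOn (fun x : ℕ → ℕ ↦ x j ≠ 1) ({j} : Finset ℕ) := fun j x y h ↦ by
    simp only [h j (by simp)]
  have h1 := measureReal_and_of_dependsOn (P := P) (dependsOn_heads (a + 1) ℓ) (hne a) (by simp)
    hξ hind
  have h2 := measureReal_and_of_dependsOn (P := P)
    (φ := fun x : ℕ → ℕ ↦ (∀ i, a + 1 ≤ i → i < a + 1 + ℓ → x i = 1) ∧ x a ≠ 1)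
    (S := Finset.Ico a (a + 1 + ℓ)) (ψ := fun x : ℕ → ℕ ↦ x (a + 1 + ℓ) ≠ 1) (fun x y h ↦ by
      have hS : ∀ i, a ≤ i → i < a + 1 + ℓ → x i = y i := fun i h1 h2 ↦ h i (by simp [h1, h2])
      simp only [eq_iff_iff]
      rw [hS a le_rfl (by omega)]
      refine and_congr_left' (forall_congr' fun i ↦ forall_congr' fun h1 ↦
        forall_congr' fun h2 ↦ ?_)
      rw [hS i (by omega) h2]) (hne _) (by simp) hξ hind
  rw [h1, measureReal_heads hp hind hone, measureReal_ne_one hp hξ hone,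
    measureReal_ne_one hp hξ hone] at h2
  rw [pow_two, ← mul_assoc, ← h2]
  congr 1
  ext ω
  simp only [RunAt, Set.mem_ofPred_eq, Nat.add_right_cancel_iff, forall_eq, ha.le, ha, true_and,
    forall_const, and_assoc]

/-- The expected number of runs of length `ℓ`. -/
lemma abs_sum_measureReal_runAt_sub_le [IsProbabilityMeasure P]
    (hp : 0 ≤ p) (hp1 : p ≤ 1) (hξ : ∀ i, Measurable (ξ i))
    (hind : iIndepFun ξ P) (hone : ∀ i, P {ω | ξ i ω = 1} = ENNReal.ofReal p) (ℓ n : ℕ) :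
    |∑ a ∈ Finset.range n, P.real {ω | RunAt (fun i ↦ ξ i ω) ℓ n a} -
      n * (p ^ ℓ * (1 - p) ^ 2)| ≤ (ℓ + 1) * p ^ ℓ := by
  have hpl : 0 ≤ p ^ ℓ := pow_nonneg hp ℓ
  have hq : (1 - p) ^ 2 ≤ 1 := pow_le_one₀ (by linarith) (by linarith)
  -- The exceptional starts, at most `ℓ + 1` of them, are `0` and those at or after `n - ℓ`, where a
  -- bounding tail is not required or the run does not fit.
  have hterm : ∀ a ∈ Finset.range n,
      |P.real {ω | RunAt (fun i ↦ ξ i ω) ℓ n a} - p ^ ℓ * (1 - p) ^ 2| ≤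
        if a ∈ insert 0 (Finset.Ico (n - ℓ) n) then p ^ ℓ else 0 := by
    intro a ha
    rw [Finset.mem_range] at ha
    split_ifs with h
    · refine abs_sub_le_of_nonneg_of_le measureReal_nonneg
        (measureReal_runAt_le hp hind hone ..) (by positivity)
        (mul_le_of_le_one_right hpl hq)
    · simp only [Finset.mem_insert, Finset.mem_Ico, not_or] at h
      obtain ⟨b, rfl⟩ := Nat.exists_eq_succ_of_ne_zero h.1
      rw [measureReal_runAt hp hξ hind hone (by omega)]
      simp
  calc _ = |∑ a ∈ Finset.range n,
        (P.real {ω | RunAt (fun i ↦ ξ i ω) ℓ n a} - p ^ ℓ * (1 - p) ^ 2)| := by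
        simp [Finset.sum_sub_distrib]
    _ ≤ ∑ a ∈ Finset.range n, if a ∈ insert 0 (Finset.Ico (n - ℓ) n) then p ^ ℓ else 0 :=
        (Finset.abs_sum_le_sum_abs _ _).trans (Finset.sum_le_sum hterm)
    _ ≤ (insert 0 (Finset.Ico (n - ℓ) n)).card * p ^ ℓ := by
        rw [← Finset.sum_filter, Finset.sum_const, nsmul_eq_mul]
        gcongr
        intro a ha
        exact (Finset.mem_filter.1 ha).2
    _ ≤ (ℓ + 1) * p ^ ℓ := by
        gcongr
        have h1 := Finset.card_insert_le 0 (Finset.Ico (n - ℓ) n)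
        rw [Nat.card_Ico] at h1
        exact_mod_cast (show _ ≤ ℓ + 1 by omega)

lemma measureReal_headsNear_le [IsProbabilityMeasure P] (hp : 0 ≤ p) (hind : iIndepFun ξ P)
    (hone : ∀ i, P {ω | ξ i ω = 1} = ENNReal.ofReal p) (ℓ ℓ' a : ℕ) :
    P.real {ω | HeadsNear (fun i ↦ ξ i ω) ℓ ℓ' a} ≤ (ℓ + ℓ' + 3) * p ^ ℓ' := by
  calc _ ≤ P.real (⋃ b ∈ Finset.Icc (a - ℓ' - 1) (a + ℓ + 1),
        {ω | ∀ i, b ≤ i → i < b + ℓ' → ξ i ω = 1}) := by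
        refine measureReal_mono ?_ (measure_ne_top _ _)
        rintro ω ⟨b, h1, h2, h3⟩
        simp only [Set.mem_iUnion]
        exact ⟨b, Finset.mem_Icc.2 (by omega), h3⟩
    _ ≤ ∑ b ∈ Finset.Icc (a - ℓ' - 1) (a + ℓ + 1), p ^ ℓ' := by
        refine (measureReal_biUnion_finset_le _ _).trans (Finset.sum_le_sum fun b _ ↦ ?_)
        rw [measureReal_heads hp hind hone]
    _ ≤ (ℓ + ℓ' + 3) * p ^ ℓ' := by
        rw [Finset.sum_const, nsmul_eq_mul, Nat.card_Icc]
        gcongr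
        exact_mod_cast (show _ ≤ ℓ + ℓ' + 3 by omega)

lemma measurableSet_runAt (hξ : ∀ i, Measurable (ξ i)) {ℓ : ℕ} (hℓ : 0 < ℓ) (n a : ℕ) :
    MeasurableSet {ω | RunAt (fun i ↦ ξ i ω) ℓ n a} :=
  (dependsOn_runAt hℓ n a).measurableSet_setOf hξ

lemma measurable_runCount (hξ : ∀ i, Measurable (ξ i)) {ℓ : ℕ} (hℓ : 0 < ℓ) (n : ℕ) :
    Measurable fun ω ↦ runCount (fun i ↦ ξ i ω) ℓ n := by
  refine measurable_to_countable' fun m ↦ ?_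
  have h : DependsOn (fun x ↦ runCount x ℓ n = m) (Finset.range n) := fun x y h ↦ by
    beta_reduce
    rw [runCount_congr hℓ fun i hi ↦ by rw [h i (by simpa using hi)]]
  exact h.measurableSet_setOf hξ

open Classical in
lemma runCount_eq_sum_indicator {Ω : Type*} {ξ : ℕ → Ω → ℕ} {ℓ : ℕ} (hℓ : 0 < ℓ) (n : ℕ)
    (ω : Ω) : (runCount (fun i ↦ ξ i ω) ℓ n : ℝ) =
      ∑ a ∈ Finset.range n, {ω | RunAt (fun i ↦ ξ i ω) ℓ n a}.indicator 1 ω := by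
  rw [runCount_eq_card hℓ, Finset.card_filter]
  simp [Set.indicator_apply]

/-- Double counting: the sum of the run indicators is the run count, constant on `B`. -/
lemma sum_measureReal_runAt_inter [IsProbabilityMeasure P]
    (hξ : ∀ i, Measurable (ξ i)) {ℓ n m : ℕ} (hℓ : 0 < ℓ)
    {B : Set Ω} (hB : MeasurableSet B) (hBm : ∀ ω ∈ B, runCount (fun i ↦ ξ i ω) ℓ n = m) :
    ∑ a ∈ Finset.range n, P.real ({ω | RunAt (fun i ↦ ξ i ω) ℓ n a} ∩ B) = m * P.real B := by
  classical
  calc _ = ∑ a ∈ Finset.range n,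
        ∫ ω, ({ω | RunAt (fun i ↦ ξ i ω) ℓ n a} ∩ B).indicator (1 : Ω → ℝ) ω ∂P := by
        refine Finset.sum_congr rfl fun a _ ↦ ?_
        rw [integral_indicator_one ((measurableSet_runAt hξ hℓ n a).inter hB)]
    _ = ∫ ω, B.indicator (fun _ ↦ (m : ℝ)) ω ∂P := by
        rw [← integral_finsetSum]
        · refine integral_congr_ae (.of_forall fun ω ↦ ?_)
          by_cases hω : ω ∈ B
          · rw [Set.indicator_of_mem hω]
            rw [← hBm ω hω, runCount_eq_sum_indicator hℓ]
            refine Finset.sum_congr rfl fun a _ ↦ ?_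
            rw [Set.indicator_apply, Set.indicator_apply]
            simp [hω]
          · simp [hω]
        · intro a _
          exact (integrable_const (1 : ℝ)).indicator ((measurableSet_runAt hξ hℓ n a).inter hB)
    _ = m * P.real B := by
        rw [integral_indicator_const _ hB, smul_eq_mul, mul_comm]

lemma mul_measureReal_le_runCount_le [IsProbabilityMeasure P]
    (hξ : ∀ i, Measurable (ξ i)) {ℓ : ℕ} (hℓ : 0 < ℓ)
    (n K : ℕ) :
    K * P.real {ω | K ≤ runCount (fun i ↦ ξ i ω) ℓ n} ≤
      ∑ a ∈ Finset.range n, P.real {ω | RunAt (fun i ↦ ξ i ω) ℓ n a} := by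
  have hint : ∀ a ∈ Finset.range n, Integrable
      ({ω | RunAt (fun i ↦ ξ i ω) ℓ n a}.indicator (1 : Ω → ℝ)) P := fun a _ ↦
    (integrable_const (1 : ℝ)).indicator (measurableSet_runAt hξ hℓ n a)
  have h := mul_meas_ge_le_integral_of_nonneg (μ := P)
    (f := fun ω ↦ (runCount (fun i ↦ ξ i ω) ℓ n : ℝ)) (.of_forall fun _ ↦ Nat.cast_nonneg _)
    (by simp only [runCount_eq_sum_indicator hℓ]; exact integrable_finsetSum _ hint) K
  simp only [runCount_eq_sum_indicator hℓ] at h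
  rw [integral_finsetSum _ hint] at h
  simp only [integral_indicator_one (measurableSet_runAt hξ hℓ n _),
    ← runCount_eq_sum_indicator hℓ, Nat.cast_le] at h
  exact h

/-- Where the run is already present, planting it changes no count; and the counts after planting
depend only on tosses outside the overwritten positions, hence are independent of the run. -/
lemma measureReal_runAt_and_runCount (hξ : ∀ i, Measurable (ξ i)) (hind : iIndepFun ξ P)
    {ι : Type*} {ℓ : ι → ℕ} (hℓ : ∀ j, 0 < ℓ j) {m : ℕ} (hm : 0 < m) (n a : ℕ) (r : ι → ℕ) :
    P.real {ω | RunAt (fun i ↦ ξ i ω) m n a ∧ ∀ j, runCount (fun i ↦ ξ i ω) (ℓ j) n = r j} =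
      P.real {ω | RunAt (fun i ↦ ξ i ω) m n a} *
        P.real {ω | ∀ j, runCount (plantRun (fun i ↦ ξ i ω) m a) (ℓ j) n = r j} := by
  rw [← measureReal_and_of_dependsOn
    (ψ := fun x ↦ ∀ j, runCount (plantRun x m a) (ℓ j) n = r j)
    (T := Finset.range n \ Finset.Icc (a - 1) (a + m)) (dependsOn_runAt hm n a) _
    Finset.disjoint_sdiff hξ hind]
  · congr 1
    ext ω
    refine and_congr_right fun h ↦ forall_congr' fun j ↦ ?_
    rw [h.runCount_plantRun (hℓ j)]
  · intro x y h
    simp only [eq_iff_iff]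
    refine forall_congr' fun j ↦ ?_
    rw [runCount_congr (hℓ j) fun i hi ↦ ?_]
    unfold plantRun
    split_ifs with h1 h2
    · rfl
    · rfl
    · rw [h i]
      simp only [Finset.coe_sdiff, Finset.coe_range, Finset.coe_Icc, Set.mem_sdiff, Set.mem_Iio,
        Set.mem_Icc]
      omega

lemma abs_measureReal_sub_le_of_iff [IsProbabilityMeasure P]
    {A B C : Set Ω} (h : ∀ ω, ω ∉ C → (ω ∈ A ↔ ω ∈ B)) :
    |P.real A - P.real B| ≤ P.real C := by
  have key : ∀ A B : Set Ω, (∀ ω, ω ∉ C → (ω ∈ A ↔ ω ∈ B)) → P.real A ≤ P.real B + P.real C :=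
    fun A B h ↦ (measureReal_mono fun ω hω ↦ by
      by_cases hC : ω ∈ C
      · exact Or.inr hC
      · exact Or.inl ((h ω hC).1 hω)).trans (measureReal_union_le B C)
  have h1 := key A B h
  have h2 := key B A fun ω hω ↦ (h ω hω).symm
  rw [abs_le]
  constructor <;> linarith

/-- The approximate Stein identity for the vector of run counts. -/
lemma abs_stein_runCount_le [IsProbabilityMeasure P]
    (hp : 0 ≤ p) (hξ : ∀ i, Measurable (ξ i)) (hind : iIndepFun ξ P)
    (hone : ∀ i, P {ω | ξ i ω = 1} = ENNReal.ofReal p) {ι : Type*} [Fintype ι] [DecidableEq ι]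
    {ℓ : ι → ℕ} (hℓ : ∀ j, 0 < ℓ j) (hinj : Function.Injective ℓ) (n : ℕ) (r : ι → ℕ) (j : ι) :
    |(r j + 1) * P.real {ω | ∀ i, runCount (fun i ↦ ξ i ω) (ℓ i) n = (r + Pi.single j 1 : ι → ℕ) i} -
        (∑ a ∈ Finset.range n, P.real {ω | RunAt (fun i ↦ ξ i ω) (ℓ j) n a}) *
          P.real {ω | ∀ i, runCount (fun i ↦ ξ i ω) (ℓ i) n = r i}| ≤
      (∑ a ∈ Finset.range n, P.real {ω | RunAt (fun i ↦ ξ i ω) (ℓ j) n a}) *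
        ∑ i, (ℓ j + ℓ i + 3) * p ^ ℓ i := by
  set B := {ω | ∀ i, runCount (fun i ↦ ξ i ω) (ℓ i) n = (r + Pi.single j 1 : ι → ℕ) i} with hBdef
  have hB : MeasurableSet B := by
    rw [hBdef, Set.ofPred_forall]
    exact MeasurableSet.iInter fun i ↦ measurable_runCount hξ (hℓ i) n (MeasurableSet.singleton _)
  have hsum := sum_measureReal_runAt_inter (P := P) (m := r j + 1) hξ (hℓ j) hB
    fun ω hω ↦ by simpa using hω j
  push_cast at hsum
  rw [← hsum, Finset.sum_mul, Finset.sum_mul, ← Finset.sum_sub_distrib]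
  refine (Finset.abs_sum_le_sum_abs _ _).trans (Finset.sum_le_sum fun a _ ↦ ?_)
  have hprod := measureReal_runAt_and_runCount hξ hind hℓ (hℓ j) n a (r + Pi.single j 1)
  change P.real ({ω | RunAt (fun i ↦ ξ i ω) (ℓ j) n a} ∩ B) = _ at hprod
  rw [hprod, ← mul_sub, abs_mul, abs_of_nonneg measureReal_nonneg]
  by_cases ha : a + ℓ j ≤ n
  · refine mul_le_mul_of_nonneg_left ?_ measureReal_nonneg
    refine (abs_measureReal_sub_le_of_iff
      (C := ⋃ i, {ω | HeadsNear (fun i ↦ ξ i ω) (ℓ j) (ℓ i) a}) fun ω hω ↦ ?_).trans ?_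
    · simp only [Set.mem_iUnion, not_exists] at hω
      refine forall_congr' fun i ↦ ?_
      -- As the lengths are distinct, planting raises only the `j`-th count.
      rw [runCount_plantRun (hℓ j) (hℓ i) ha (hω i)]
      simp [hinj.eq_iff, Pi.single_apply]
    · exact (measureReal_iUnion_fintype_le _).trans
        (Finset.sum_le_sum fun i _ ↦ measureReal_headsNear_le hp hind hone ..)
  · have : {ω | RunAt (fun i ↦ ξ i ω) (ℓ j) n a} = ∅ :=
      Set.eq_empty_of_forall_notMem fun ω h ↦ ha h.1
    simp [this]

end CoinTosses

/-! ### Weak convergence from point masses. -/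

/-- On a countable space, convergence of the point masses to those of a probability measure implies
weak convergence. -/
lemma ProbabilityMeasure.tendsto_of_forall_tendsto_singleton {E ι : Type*} [MeasurableSpace E]
    [TopologicalSpace E] [OpensMeasurableSpace E] [Countable E] [MeasurableSingletonClass E]
    {l : Filter ι} [l.IsCountablyGenerated] {μs : ι → ProbabilityMeasure E}
    {μ : ProbabilityMeasure E}
    (h : ∀ x, Tendsto (fun i ↦ (μs i : Measure E) {x}) l (𝓝 ((μ : Measure E) {x}))) :
    Tendsto μs l (𝓝 μ) := by
  refine tendsto_of_seq_tendsto fun u hu ↦ ?_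
  refine tendsto_of_forall_isOpen_le_liminf' fun G hG ↦ ?_
  have hsum : ∀ ρ : Measure E,
      ρ G = ∫⁻ x, G.indicator (fun x ↦ ρ {x}) x ∂Measure.count := fun ρ ↦ by
    rw [lintegral_count, Measure.tsum_indicator_apply_singleton ρ G hG.measurableSet]
  simp only [hsum]
  -- The portmanteau condition on open sets is Fatou's lemma for counting measure.
  refine le_trans (lintegral_mono fun x ↦ ?_)
    (lintegral_liminf_le fun _ ↦ Measurable.of_discrete)
  by_cases hx : x ∈ G
  · simp only [Set.indicator_of_mem hx]
    exact ((h x).comp hu).liminf_eq.ge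
  · simp [hx]

/-! ### From approximate Stein identities to Poisson limits. -/

section Stein

variable {ι : Type*} [Fintype ι] [DecidableEq ι]

-- The unnormalised Poisson weights solve the Stein recursion exactly.
open Nat in
lemma prod_pow_div_factorial_add_single (lam : ι → ℝ) (s : ι → ℕ) (j : ι) :
    (s j + 1) * ∏ i, lam i ^ (s + Pi.single j 1 : ι → ℕ) i / ((s + Pi.single j 1 : ι → ℕ) i)! =
      lam j * ∏ i, lam i ^ s i / (s i)! := by
  rw [← Finset.mul_prod_erase _ _ (Finset.mem_univ j),
    ← Finset.mul_prod_erase _ (fun i ↦ lam i ^ s i / ((s i)! : ℝ)) (Finset.mem_univ j)]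
  rw [Finset.prod_congr rfl (g := fun i ↦ lam i ^ s i / ((s i)! : ℝ)) fun i hi ↦ by
    simp [Pi.single_eq_of_ne (Finset.ne_of_mem_erase hi)]]
  have h1 : ((s j)! : ℝ) ≠ 0 := by positivity
  have h2 : (s j + 1 : ℝ) ≠ 0 := by positivity
  simp only [Pi.add_apply, Pi.single_eq_same, Nat.factorial_succ, pow_succ, Nat.cast_mul,
    Nat.cast_succ]
  field_simp

lemma exists_eq_add_single {r : ι → ℕ} (hr : r ≠ 0) :
    ∃ (s : ι → ℕ) (j : ι), r = s + Pi.single j 1 ∧ ∑ i, r i = ∑ i, s i + 1 := by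
  obtain ⟨j, hj⟩ := Function.ne_iff.1 hr
  have h : r = r - Pi.single j 1 + Pi.single j 1 := by
    ext i
    rcases eq_or_ne i j with rfl | hij
    · simp only [Pi.add_apply, Pi.sub_apply, Pi.single_eq_same]
      simp only [Pi.zero_apply] at hj
      omega
    · simp [hij]
  refine ⟨r - Pi.single j 1, j, h, ?_⟩
  conv_lhs => rw [h]
  simp only [Pi.add_apply, Finset.sum_add_distrib, Finset.sum_pi_single', Finset.mem_univ, if_true]

variable {μ : ℕ → Measure (ι → ℕ)} [∀ k, IsProbabilityMeasure (μ k)] {lam : ι → ℝ}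
  {L : ι → ℕ → ℝ}

-- Induction on the sum of the coordinates of `r`: each Stein identity lowers one coordinate by one,
-- and replacing `L j k` by `lam j` costs a vanishing error because point masses are at most 1.
open Nat in
lemma tendsto_measureReal_sub_of_stein
    (hL : ∀ j, Tendsto (L j) atTop (𝓝 (lam j)))
    (hstein : ∀ (r : ι → ℕ) j, Tendsto (fun k ↦
      (r j + 1) * (μ k).real {r + Pi.single j 1} - L j k * (μ k).real {r}) atTop (𝓝 0))
    (r : ι → ℕ) :
    Tendsto (fun k ↦ (μ k).real {r} - (∏ j, lam j ^ r j / (r j)!) * (μ k).real {0})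
      atTop (𝓝 0) := by
  induction hn : ∑ i, r i generalizing r with
  | zero =>
    have : r = 0 := by
      ext i
      exact (Finset.sum_eq_zero_iff.1 hn) i (Finset.mem_univ i)
    subst this
    simp
  | succ n ih =>
    obtain ⟨s, j, rfl, hs⟩ := exists_eq_add_single (r := r) (by rintro rfl; simp at hn)
    have hne : (s j + 1 : ℝ) ≠ 0 := by positivity
    have h1 : Tendsto (fun k ↦ (L j k - lam j) * (μ k).real {s}) atTop (𝓝 0) := by
      refine squeeze_zero_norm (a := fun k ↦ ‖L j k - lam j‖) (fun k ↦ ?_) ?_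
      · rw [norm_mul]
        refine mul_le_of_le_one_right (norm_nonneg _) ?_
        rw [Real.norm_of_nonneg measureReal_nonneg]
        exact measureReal_le_one
      · simpa using ((hL j).sub_const (lam j)).norm
    have h := (((hstein s j).add h1).add ((ih s (by omega)).const_mul (lam j))).const_mul
      (s j + 1 : ℝ)⁻¹
    simp only [add_zero, mul_zero] at h
    refine h.congr fun k ↦ ?_
    rw [inv_mul_eq_iff_eq_mul₀ hne]
    linear_combination (μ k).real {0} * prod_pow_div_factorial_add_single lam s j

/-- Tightness: a union bound over the coordinates, with Markov's inequality for each. -/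
lemma measureReal_box_ge (hmarkov : ∀ j k (K : ℕ), K * (μ k).real {r | K ≤ r j} ≤ L j k)
    {K : ℕ} (hK : 0 < K) (k : ℕ) :
    1 - (∑ j, L j k) / K ≤ (μ k).real (Fintype.piFinset fun _ : ι ↦ Finset.range K) := by
  have hK' : (0 : ℝ) < K := by positivity
  have h1 : (μ k).real ((Fintype.piFinset fun _ : ι ↦ Finset.range K : Set (ι → ℕ)))ᶜ ≤
      (∑ j, L j k) / K := by
    calc _ ≤ (μ k).real (⋃ j, {r | K ≤ r j}) := by
          refine measureReal_mono fun r hr ↦ ?_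
          simpa using hr
      _ ≤ ∑ j, (μ k).real {r | K ≤ r j} := measureReal_iUnion_fintype_le _
      _ ≤ ∑ j, L j k / K := Finset.sum_le_sum fun j _ ↦ by
          rw [le_div_iff₀' hK']
          exact hmarkov j k K
      _ = _ := by rw [Finset.sum_div]
  rw [probReal_compl_eq_one_sub (Finset.measurableSet _)] at h1
  linarith

open Nat in
lemma tendsto_sum_box_prod_pow_div_factorial (lam : ι → ℝ) :
    Tendsto (fun K ↦ ∑ r ∈ Fintype.piFinset fun _ : ι ↦ Finset.range K,
      ∏ j, lam j ^ r j / (r j)!) atTop (𝓝 (∏ j, Real.exp (lam j))) := by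
  have h : ∀ j, Tendsto (fun K ↦ ∑ i ∈ Finset.range K, lam j ^ i / (i ! : ℝ)) atTop
      (𝓝 (Real.exp (lam j))) := fun j ↦ by
    rw [Real.exp_eq_exp_ℝ]
    exact (NormedSpace.expSeries_div_hasSum_exp (lam j)).tendsto_sum_nat
  simpa only [Finset.prod_univ_sum] using tendsto_finsetProd Finset.univ fun j _ ↦ h j

lemma tendsto_measureReal_zero_of_stein
    (hL : ∀ j, Tendsto (L j) atTop (𝓝 (lam j)))
    (hstein : ∀ (r : ι → ℕ) j, Tendsto (fun k ↦
      (r j + 1) * (μ k).real {r + Pi.single j 1} - L j k * (μ k).real {r}) atTop (𝓝 0))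
    (hmarkov : ∀ j k (K : ℕ), K * (μ k).real {r | K ≤ r j} ≤ L j k) :
    Tendsto (fun k ↦ (μ k).real {0} * ∏ j, Real.exp (lam j)) atTop (𝓝 1) := by
  rw [Metric.tendsto_atTop']
  intro ε hε
  have hC : Tendsto (fun k ↦ ∑ j, L j k) atTop (𝓝 (∑ j, lam j)) :=
    tendsto_finsetSum _ fun j _ ↦ hL j
  have hCK : Tendsto (fun K : ℕ ↦ (∑ j, lam j + 1) / K) atTop (𝓝 0) :=
    tendsto_const_div_atTop_nhds_zero_nat _
  -- `K` is fixed before `k`: it makes the box sum of weights close to its limit and the mass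
  -- outside the box small, uniformly once the means sum to less than `∑ j, lam j + 1`.
  obtain ⟨K, hK, hKE, hKC⟩ := ((eventually_gt_atTop 0).and
    (((tendsto_sum_box_prod_pow_div_factorial lam).eventually
      (Metric.ball_mem_nhds _ (by positivity : 0 < ε / 3))).and
        (hCK.eventually (gt_mem_nhds (by positivity : 0 < ε / 3))))).exists
  have hbox := tendsto_finsetSum (Fintype.piFinset fun _ : ι ↦ Finset.range K)
    fun r _ ↦ tendsto_measureReal_sub_of_stein hL hstein r
  simp only [Finset.sum_const_zero, Finset.sum_sub_distrib, ← Finset.sum_mul,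
    sum_measureReal_singleton] at hbox
  obtain ⟨k₀, hk₀⟩ := eventually_atTop.1
    ((hbox.eventually (Metric.ball_mem_nhds _ (by positivity : 0 < ε / 3))).and
      (hC.eventually (gt_mem_nhds (lt_add_one _))))
  refine ⟨k₀, fun k hk ↦ ?_⟩
  obtain ⟨h1, h2⟩ := hk₀ k hk.le
  simp only [Real.dist_eq, sub_zero] at h1 hKE ⊢
  set c := (μ k).real {0}
  set E := ∏ j, Real.exp (lam j)
  set W := ∑ r ∈ Fintype.piFinset fun _ : ι ↦ Finset.range K,
      ∏ j, lam j ^ r j / ((r j).factorial : ℝ)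
  set B := (μ k).real (Fintype.piFinset fun _ : ι ↦ Finset.range K)
  have hB1 : B ≤ 1 := measureReal_le_one
  have hB2 : 1 - (∑ j, lam j + 1) / K ≤ B := by
    refine le_trans ?_ (measureReal_box_ge hmarkov hK k)
    gcongr
  have hc0 : 0 ≤ c := measureReal_nonneg
  have hc1 : c ≤ 1 := measureReal_le_one
  have h3 : |c * (E - W)| < ε / 3 := by
    rw [abs_mul, abs_of_nonneg hc0, abs_sub_comm]
    exact (mul_le_of_le_one_left (abs_nonneg _) hc1).trans_lt hKE
  -- The three errors come from c·E − 1 = c·(E − W) − (B − W·c) + (B − 1).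
  rw [abs_lt] at h1 h3 ⊢
  constructor <;> linarith

open Nat in
/-- A sequence of probability measures on `ι → ℕ` satisfying the Stein identities of a product of
Poisson measures up to a vanishing error converges pointwise to that product. -/
lemma tendsto_measureReal_singleton_of_stein
    (hL : ∀ j, Tendsto (L j) atTop (𝓝 (lam j)))
    (hstein : ∀ (r : ι → ℕ) j, Tendsto (fun k ↦
      (r j + 1) * (μ k).real {r + Pi.single j 1} - L j k * (μ k).real {r}) atTop (𝓝 0))
    (hmarkov : ∀ j k (K : ℕ), K * (μ k).real {r | K ≤ r j} ≤ L j k) (r : ι → ℕ) :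
    Tendsto (fun k ↦ (μ k).real {r}) atTop
      (𝓝 (∏ j, Real.exp (-lam j) * lam j ^ r j / (r j)!)) := by
  have hE : ∏ j, Real.exp (lam j) ≠ 0 := Finset.prod_ne_zero_iff.2 fun j _ ↦ Real.exp_ne_zero _
  have h1 := (tendsto_measureReal_zero_of_stein hL hstein hmarkov).div_const
    (∏ j, Real.exp (lam j))
  simp only [mul_div_cancel_right₀ _ hE] at h1
  have h2 := (tendsto_measureReal_sub_of_stein hL hstein r).add
    (h1.const_mul (∏ j, lam j ^ r j / ((r j)! : ℝ)))
  simp only [sub_add_cancel, zero_add] at h2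
  convert h2 using 2
  simp only [mul_div_assoc, Finset.prod_mul_distrib, Real.exp_neg, Finset.prod_inv_distrib]
  ring

end Stein

/-! ### Growth of the run lengths. -/

section Asymptotics

variable {p θ η : ℝ} {N l m : ℕ → ℕ}

lemma tendsto_atTop_of_tendsto_mul_pow (hp0 : 0 < p) (hp1 : p < 1) (hN : Tendsto N atTop atTop)
    (hl : Tendsto (fun k ↦ (N k : ℝ) * p ^ l k * (1 - p)) atTop (𝓝 θ)) :
    Tendsto l atTop atTop := by
  have hq : 0 < 1 - p := sub_pos.2 hp1
  have hNr : Tendsto (fun k ↦ (N k : ℝ) * (1 - p)) atTop atTop :=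
    (tendsto_natCast_atTop_atTop.comp hN).atTop_mul_const hq
  have h0 : Tendsto (fun k ↦ p ^ l k) atTop (𝓝 0) := by
    refine (hl.div_atTop hNr).congr' ?_
    filter_upwards [hNr.eventually_gt_atTop 0] with k hk
    rw [mul_right_comm, mul_div_cancel_left₀ _ hk.ne']
  refine tendsto_atTop.2 fun M ↦ ?_
  filter_upwards [h0.eventually (gt_mem_nhds (pow_pos hp0 M))] with k hk
  exact ((pow_lt_pow_iff_right_of_lt_one₀ hp0 hp1).1 hk).le

/-- Write l·p^m as (l·p^l) · (N·p^m·q)/(N·p^l·q): the first factor tends to 0 since l → ∞, and the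
quotient tends to η/θ. -/
lemma tendsto_mul_pow_zero (hp0 : 0 < p) (hp1 : p < 1) (hN : Tendsto N atTop atTop)
    (hθ : θ ≠ 0) (hl : Tendsto (fun k ↦ (N k : ℝ) * p ^ l k * (1 - p)) atTop (𝓝 θ))
    (hm : Tendsto (fun k ↦ (N k : ℝ) * p ^ m k * (1 - p)) atTop (𝓝 η)) :
    Tendsto (fun k ↦ (l k : ℝ) * p ^ m k) atTop (𝓝 0) := by
  have hq : 1 - p ≠ 0 := (sub_pos.2 hp1).ne'
  have h1 : Tendsto (fun k ↦ (l k : ℝ) * p ^ l k) atTop (𝓝 0) :=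
    (tendsto_self_mul_const_pow_of_lt_one hp0.le hp1).comp
      (tendsto_atTop_of_tendsto_mul_pow hp0 hp1 hN hl)
  have h2 := h1.mul (hm.div hl hθ)
  rw [zero_mul] at h2
  refine h2.congr' ?_
  filter_upwards [hN.eventually_gt_atTop 0] with k hk
  have : (N k : ℝ) ≠ 0 := by positivity
  have := (pow_pos hp0 (l k)).ne'
  rw [Pi.div_apply]
  field_simp

end Asymptotics

/-! ### The Poisson limit. -/

theorem mainTheorem4 {Ω : Type*} [MeasurableSpace Ω] (P : Measure Ω) [IsProbabilityMeasure P]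
    (p : ℝ) (hp0 : 0 < p) (hp1 : p < 1)
    (ξ : ℕ → Ω → ℕ) (hξ_meas : ∀ i, Measurable (ξ i)) (hξ_indep : iIndepFun ξ P)
    (hξ_one : ∀ i, P {ω | ξ i ω = 1} = ENNReal.ofReal p)
    (hξ_zero : ∀ i, P {ω | ξ i ω = 0} = ENNReal.ofReal (1 - p))
    (ν : ℕ) (θ : Fin ν → ℝ) (hθ : ∀ j, 0 < θ j)
    (N : ℕ → ℕ) (hN : Tendsto N atTop atTop)
    (ℓ : Fin ν → ℕ → ℕ) (hℓ_pos : ∀ j k, 0 < ℓ j k)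
    (hℓ_distinct : ∀ k i j, i ≠ j → ℓ i k ≠ ℓ j k)
    (hℓ : ∀ j, Tendsto (fun k ↦ (N k : ℝ) * p ^ ℓ j k * (1 - p)) atTop (𝓝 (θ j))) :
    TendstoInDistribution
      (fun (k : ℕ) (ω : Ω) (j : Fin ν) ↦ runCount (fun i ↦ ξ i ω) (ℓ j k) (N k))
      atTop (id : (Fin ν → ℕ) → (Fin ν → ℕ)) (fun _ ↦ P)
      (Measure.pi fun j ↦ poissonMeasure (θ j * (1 - p)).toNNReal) := by
  have hq : 0 < 1 - p := sub_pos.2 hp1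
  set X := fun (k : ℕ) (ω : Ω) (j : Fin ν) ↦ runCount (fun i ↦ ξ i ω) (ℓ j k) (N k)
  have hX : ∀ k, Measurable (X k) := fun k ↦
    measurable_pi_lambda _ fun j ↦ measurable_runCount hξ_meas (hℓ_pos j k) (N k)
  have hprob : ∀ k, IsProbabilityMeasure (P.map (X k)) := fun k ↦
    Measure.isProbabilityMeasure_map (hX k).aemeasurable
  let L : Fin ν → ℕ → ℝ := fun j k ↦
    ∑ a ∈ Finset.range (N k), P.real {ω | RunAt (fun i ↦ ξ i ω) (ℓ j k) (N k) a}
  have hmul : ∀ i j, Tendsto (fun k ↦ (ℓ i k : ℝ) * p ^ ℓ j k) atTop (𝓝 0) := fun i j ↦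
    tendsto_mul_pow_zero hp0 hp1 hN (hθ i).ne' (hℓ i) (hℓ j)
  have hpow : ∀ j, Tendsto (fun k ↦ p ^ ℓ j k) atTop (𝓝 0) := fun j ↦
    (tendsto_pow_atTop_nhds_zero_of_lt_one hp0.le hp1).comp
      (tendsto_atTop_of_tendsto_mul_pow hp0 hp1 hN (hℓ j))
  -- An interior run needs a tail on both sides, so the mean is about N·p^ℓ·q², one factor q more
  -- than the hypothesis on `θ j`.
  have hL : ∀ j, Tendsto (L j) atTop (𝓝 (θ j * (1 - p))) := fun j ↦ by
    have h1 : Tendsto (fun k ↦ L j k - N k * (p ^ ℓ j k * (1 - p) ^ 2)) atTop (𝓝 0) :=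
      squeeze_zero_norm (fun k ↦ abs_sum_measureReal_runAt_sub_le hp0.le hp1.le hξ_meas hξ_indep
        hξ_one (ℓ j k) (N k)) (by simpa [add_mul] using (hmul j j).add (hpow j))
    have h2 := h1.add ((hℓ j).mul_const (1 - p))
    rw [zero_add] at h2
    exact h2.congr fun k ↦ by ring
  have hreal : ∀ k (s : Set (Fin ν → ℕ)), (P.map (X k)).real s = P.real (X k ⁻¹' s) := fun k s ↦
    map_measureReal_apply (hX k) (Set.to_countable s).measurableSet
  have hsingle : ∀ k (r : Fin ν → ℕ), X k ⁻¹' {r} =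
      {ω | ∀ j, runCount (fun i ↦ ξ i ω) (ℓ j k) (N k) = r j} := fun k r ↦ by
    ext ω
    simp [X, funext_iff]
  have hpoint : ∀ r : Fin ν → ℕ, Tendsto (fun k ↦ (P.map (X k)).real {r}) atTop
      (𝓝 ((Measure.pi fun j ↦ poissonMeasure (θ j * (1 - p)).toNNReal).real {r})) := fun r ↦ by
    have h := tendsto_measureReal_singleton_of_stein (μ := fun k ↦ P.map (X k)) hL
      (fun r j ↦ ?_) (fun j k K ↦ ?_) r
    · rw [measureReal_def, Measure.pi_singleton, ENNReal.toReal_prod]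
      simp only [← measureReal_def, poissonMeasure_real_singleton,
        Real.coe_toNNReal _ (mul_pos (hθ _) hq).le]
      exact h
    · have hε : Tendsto (fun k ↦ L j k * ∑ i, ((ℓ j k : ℝ) + ℓ i k + 3) * p ^ ℓ i k) atTop
          (𝓝 0) := by
        have := (hL j).mul (tendsto_finsetSum Finset.univ fun i _ ↦
          ((hmul j i).add (hmul i i)).add ((hpow i).const_mul 3))
        simpa only [add_zero, mul_zero, Finset.sum_const_zero, ← add_mul] using this
      refine squeeze_zero_norm (fun k ↦ ?_) hε
      simp only [hreal, hsingle]
      exact abs_stein_runCount_le hp0.le hξ_meas hξ_indep hξ_one (fun i ↦ hℓ_pos i k)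
        (fun a b hab ↦ by_contra fun hne ↦ hℓ_distinct k a b hne hab) (N k) r j
    · rw [hreal]
      exact mul_measureReal_le_runCount_le hξ_meas (hℓ_pos j k) (N k) K
  refine ⟨fun k ↦ (hX k).aemeasurable, aemeasurable_id,
    ProbabilityMeasure.tendsto_of_forall_tendsto_singleton fun r ↦ ?_⟩
  simp only [ProbabilityMeasure.coe_mk, Measure.map_id]
  exact (ENNReal.tendsto_toReal_iff (fun _ ↦ measure_ne_top _ _) (measure_ne_top _ _)).1 (hpoint r)
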